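/- Let $\mathcal A$ be an arrangement of $n$ distinct affine hyperplanes in $\mathbb C^\ell$, given by nonconstant polynomials $f_1,\dots,f_n$ of degree one, with complement $U=\{x\in\mathbb C^\ell : f_j(x)\neq 0 \text{ for all } j\}$. For $\lambda\in\mathbb C^n$ let $\Phi_\lambda=\prod_j f_j^{\lambda_j}$ be the (multivalued) master function, $\operatorname{crit}(\Phi_\lambda)=\{x\in U: d\Phi_\lambda(x)=0\}$ its critical locus, and $\omega_\lambda=d\log\Phi_\lambda=\sum_j\lambda_j\, d\log f_j$. Let $A^\bullet$ be the algebra of differential forms on $U$ generated by $d\log f_1,\dots,d\log f_n$. A subspace $D\subseteq A^1$ of dimension $q$ is called *singular* if the multiplication map $\bigwedge^q D\to A^q$ is zero; its *rank* is the largest $p$ for which $\bigwedge^p D\to A^p$ is not zero. It is *rational* if it has an integral basis, i.e. there is $\Lambda=(\xi_1,\dots,\xi_q)$ with $\xi_i\in\mathbb Z^n$ such that $\omega_{\xi_1},\dots,\omega_{\xi_q}$ is a basis of $D$. Given such $\Lambda$, let $\Phi_\Lambda=(\Phi_{\xi_1},\dots,\Phi_{\xi_q})\colon U\to\mathbb C^q$,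 let $Y=\Phi_\Lambda(U)$ and let $\bar Y$ be its Zariski closure in $\mathbb C^q$. Let $\operatorname{Sing}(\Phi_\Lambda)$ be the set of points of $U$ at which the Jacobian matrix of $\Phi_\Lambda$ has rank less than $\dim Y$, let $\operatorname{Sing}(\bar Y)$ be the singular locus of the variety $\bar Y$, and put $$S_\Lambda=\operatorname{Sing}(\Phi_\Lambda)\cup\Phi_\Lambda^{-1}(\operatorname{Sing}(\bar Y))\subseteq U .$$ Let $D\subseteq A^1$ be a rational singular subspace of rank $p$ with integral basis $\Lambda=(\xi_1,\dots,\xi_q)$, and suppose $d\log\Phi_\lambda\in D$. Then: 1. $\operatorname{crit}(\Phi_\lambda)\subseteq S_\Lambda$ or $\operatorname{codim}(\operatorname{crit}(\Phi_\lambda))\le p$. (The codimension of a subvariety is the minimum of the codimensions of its irreducible components.) 2. Away from $S_\Lambda$, $\operatorname{crit}(\Phi_\lambda)$ is a union of fibers of $\Phi_\Lambda$: there is a set $T\subseteq Y$ such that $\Phi_\Lambda^{-1}(T)\subseteq\operatorname{crit}(\Phi_\lambda)$ and $\operatorname{crit}(\Phi_\lambda)- S_\Lambda=\Phi_\Lambda^{-1}(T)-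 S_\Lambda$. Each of these fibers is an intersection of level sets of the master functions: $\Phi_\Lambda^{-1}(y)=\bigcap_{i=1}^q\{x\in U:\Phi_{\xi_i}(x)=y_i\}$ for $y\in T$. -/

import Mathlib

open scoped Topology

noncomputable section

/-! ### Zariski closures, dimension, codimension, singular points in affine space -/

/-- The codimension of a (constructible) subset `Z` of `ℂ^m`: the height of the ideal of all
polynomials vanishing on `Z`, i.e. the minimum of the codimensions of the irreducible components
of the Zariski closure of `Z` (it is `⊤` when `Z` is empty). -/
def codimension {m : ℕ} (Z : Set (Fin m → ℂ)) : ℕ∞ :=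
  (MvPolynomial.vanishingIdeal ℂ Z).height

/-- The dimension of the Zariski closure of `Z ⊆ ℂ^m`: the Krull dimension of its coordinate
ring. -/
def closureDim {m : ℕ} (Z : Set (Fin m → ℂ)) : WithBot ℕ∞ :=
  ringKrullDim (MvPolynomial (Fin m) ℂ ⧸ MvPolynomial.vanishingIdeal ℂ Z)

/-- The Zariski tangent space at `y` of the Zariski closure of `Z ⊆ ℂ^m`: the common kernel of
the differentials at `y` of all polynomials vanishing on `Z`. -/
def zariskiTangentSpace {m : ℕ} (Z : Set (Fin m → ℂ)) (y : Fin m → ℂ) :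
    Submodule ℂ (Fin m → ℂ) where
  carrier := {v | ∀ P ∈ MvPolynomial.vanishingIdeal ℂ Z,
    ∑ j, MvPolynomial.eval y (MvPolynomial.pderiv j P) * v j = 0}
  zero_mem' := by intro P _; simp
  add_mem' := by
    intro v w hv hw P hP
    simp [mul_add, Finset.sum_add_distrib, hv P hP, hw P hP]
  smul_mem' := by
    intro c v hv P hP
    have h := hv P hP
    have h2 : ∑ j, MvPolynomial.eval y (MvPolynomial.pderiv j P) * (c • v) j
        = c * ∑ j, MvPolynomial.eval y (MvPolynomial.pderiv j P) * v j := by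
      rw [Finset.mul_sum]
      refine Finset.sum_congr rfl fun j _ => ?_
      simp only [Pi.smul_apply, smul_eq_mul]
      ring
    rw [h2, h, mul_zero]

/-- The singular locus of the Zariski closure `Z̄` of `Z ⊆ ℂ^m`: the points of `Z̄` at which the
Zariski tangent space has dimension larger than `dim Z̄`. (Used only for irreducible `Z̄`.) -/
def closureSing {m : ℕ} (Z : Set (Fin m → ℂ)) : Set (Fin m → ℂ) :=
  {y | (∀ P ∈ MvPolynomial.vanishingIdeal ℂ Z, MvPolynomial.eval y P = 0) ∧
    closureDim Z < (Module.finrank ℂ (zariskiTangentSpace Z y) : WithBot ℕ∞)}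

/-! ### Arrangements, logarithmic forms -/

/-- An arrangement of `n` distinct affine hyperplanes `f i = 0` in `ℂ^ℓ`, with chosen
(nonconstant) linear polynomials `f i`. -/
structure AffineArrangement (ℓ n : ℕ) where
  f : Fin n → ((Fin ℓ → ℂ) →ᵃ[ℂ] ℂ)
  linear_ne_zero : ∀ i, (f i).linear ≠ 0
  distinct : ∀ i j, {x | f i x = 0} = {x | f j x = 0} → i = j

namespace AffineArrangement

/-- The complement of the arrangement. -/
def U {ℓ n : ℕ} (A : AffineArrangement ℓ n) : Set (Fin ℓ → ℂ) :=
  {x | ∀ i, A.f i x ≠ 0}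

/-- Differential forms on `U` (sections over `U` of the exterior algebra of the cotangent space
`(ℂ^ℓ)^*`), with the pointwise wedge product. The Orlik–Solomon algebra is the subalgebra
generated by the `d log f i`. -/
def Forms {ℓ n : ℕ} (A : AffineArrangement ℓ n) : Type :=
  A.U → ExteriorAlgebra ℂ (Module.Dual ℂ (Fin ℓ → ℂ))

/-- Pointwise ring structure (the product is the wedge product). -/
instance {ℓ n : ℕ} (A : AffineArrangement ℓ n) : Ring A.Forms :=
  inferInstanceAs (Ring (A.U → ExteriorAlgebra ℂ (Module.Dual ℂ (Fin ℓ → ℂ))))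

/-- Pointwise `ℂ`-algebra structure. -/
instance {ℓ n : ℕ} (A : AffineArrangement ℓ n) : Algebra ℂ A.Forms :=
  inferInstanceAs (Algebra ℂ (A.U → ExteriorAlgebra ℂ (Module.Dual ℂ (Fin ℓ → ℂ))))

/-- The value at `x ∈ U` of a form, as an algebra homomorphism. -/
def evalAt {ℓ n : ℕ} (A : AffineArrangement ℓ n) (x : A.U) :
    A.Forms →ₐ[ℂ] ExteriorAlgebra ℂ (Module.Dual ℂ (Fin ℓ → ℂ)) :=
  Pi.evalAlgHom ℂ (fun _ : A.U => ExteriorAlgebra ℂ (Module.Dual ℂ (Fin ℓ → ℂ))) x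

/-- The one-form `d log f i = d f i / f i`. -/
def dlog {ℓ n : ℕ} (A : AffineArrangement ℓ n) (i : Fin n) : A.Forms :=
  fun x => ExteriorAlgebra.ι ℂ ((A.f i x.1)⁻¹ • (A.f i).linear)

/-- The degree-one part `A¹` of the Orlik–Solomon algebra: the span of the `d log f i`. -/
def A1 {ℓ n : ℕ} (A : AffineArrangement ℓ n) : Submodule ℂ A.Forms :=
  Submodule.span ℂ (Set.range A.dlog)

/-- The one-form `ω_λ = d log Φ_λ = ∑ λ i • d log f i`, an element of `A¹`. -/
def omega {ℓ n : ℕ} (A : AffineArrangement ℓ n) (lam : Fin n → ℂ) : A.A1 :=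
  ⟨∑ i, lam i • A.dlog i, Submodule.sum_mem _ fun i _ =>
    Submodule.smul_mem _ _ (Submodule.subset_span ⟨i, rfl⟩)⟩

/-- The inclusion of a subspace `D` of `A¹` into the algebra of forms. -/
def incl {ℓ n : ℕ} (A : AffineArrangement ℓ n) (D : Submodule ℂ A.A1) : D →ₗ[ℂ] A.Forms :=
  A.A1.subtype ∘ₗ D.subtype

/-- One-forms in `A¹` have square zero. -/
theorem incl_mul_self {ℓ n : ℕ} (A : AffineArrangement ℓ n) (D : Submodule ℂ A.A1) (w : D) :
    A.incl D w * A.incl D w = 0 := by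
  obtain ⟨c, hc⟩ := (Submodule.mem_span_range_iff_exists_fun ℂ).mp w.1.2
  have hw : A.incl D w = ∑ i, c i • A.dlog i := hc.symm
  funext x
  have h : A.evalAt x (A.incl D w) =
      ExteriorAlgebra.ι ℂ (∑ i, c i • ((A.f i x.1)⁻¹ • (A.f i).linear)) := by
    rw [hw, map_sum, map_sum]
    refine Finset.sum_congr rfl fun i _ => ?_
    rw [map_smul, map_smul]
    rfl
  have h2 : A.evalAt x (A.incl D w * A.incl D w) = 0 := by
    rw [map_mul, h, ExteriorAlgebra.ι_sq_zero]
  exact h2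

/-- The multiplication map `⋀ D → A^•` for a subspace `D` of `A¹`: the algebra homomorphism
extending the inclusion of `D`. -/
def mulMap {ℓ n : ℕ} (A : AffineArrangement ℓ n) (D : Submodule ℂ A.A1) :
    ExteriorAlgebra ℂ D →ₐ[ℂ] A.Forms :=
  ExteriorAlgebra.lift ℂ ⟨A.incl D, A.incl_mul_self D⟩

/-- The multiplication map `⋀^k D → A^k` is the zero map. -/
def MulVanishes {ℓ n : ℕ} (A : AffineArrangement ℓ n) (D : Submodule ℂ A.A1) (k : ℕ) : Prop :=
  ∀ z ∈ ⋀[ℂ]^k D, A.mulMap D z = 0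

/-- `D ⊆ A¹` is singular: `⋀^q D → A^q` is zero, where `q = dim D`. -/
def IsSingular {ℓ n : ℕ} (A : AffineArrangement ℓ n) (D : Submodule ℂ A.A1) : Prop :=
  A.MulVanishes D (Module.finrank ℂ D)

/-- `D ⊆ A¹` has rank `p`: `p` is the largest `k` such that `⋀^k D → A^k` is not zero. -/
def HasRank {ℓ n : ℕ} (A : AffineArrangement ℓ n) (D : Submodule ℂ A.A1) (p : ℕ) : Prop :=
  IsGreatest {k | ¬ A.MulVanishes D k} p

/-- `Λ = (ξ_1, …, ξ_q)` is an (ordered) integral basis of `D`: the integer vectors `ξ_i` give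
one-forms `ω_{ξ_i}` forming a basis of `D`. (`D` is rational iff it has an integral basis.) -/
def IsIntegralBasis {ℓ n q : ℕ} (A : AffineArrangement ℓ n) (D : Submodule ℂ A.A1)
    (Λ : Fin q → Fin n → ℤ) : Prop :=
  LinearIndependent ℂ (fun i => A.omega (fun j => (Λ i j : ℂ))) ∧
    Submodule.span ℂ (Set.range fun i => A.omega (fun j => (Λ i j : ℂ))) = D

/-! ### Master functions and critical loci -/

/-- `g` is, near `x`, a branch of the multivalued master function `Φ_λ = ∏ f i ^ λ i`: it is
`exp (∑ λ i L i)` for some holomorphic logarithms `L i` of the `f i` near `x`. -/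
def IsBranch {ℓ n : ℕ} (A : AffineArrangement ℓ n) (lam : Fin n → ℂ) (x : Fin ℓ → ℂ)
    (g : (Fin ℓ → ℂ) → ℂ) : Prop :=
  ∃ L : Fin n → (Fin ℓ → ℂ) → ℂ,
    (∀ i, AnalyticAt ℂ (L i) x ∧ ∀ᶠ y in 𝓝 x, Complex.exp (L i y) = A.f i y) ∧
    ∀ᶠ y in 𝓝 x, g y = Complex.exp (∑ i, lam i * L i y)

/-- The critical locus `{x ∈ U | dΦ_λ(x) = 0}`. Two branches of `Φ_λ` at `x` differ by a nonzero
constant factor near `x`, so the condition does not depend on the branch. -/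
def crit {ℓ n : ℕ} (A : AffineArrangement ℓ n) (lam : Fin n → ℂ) : Set (Fin ℓ → ℂ) :=
  {x | x ∈ A.U ∧ ∃ g, A.IsBranch lam x g ∧ HasFDerivAt g (0 : (Fin ℓ → ℂ) →L[ℂ] ℂ) x}

/-- The single-valued master function `Φ_ξ = ∏ f j ^ ξ j` of an integer vector `ξ`
(meaningful on `U`). -/
def master {ℓ n : ℕ} (A : AffineArrangement ℓ n) (ξ : Fin n → ℤ) (x : Fin ℓ → ℂ) : ℂ :=
  ∏ j, A.f j x ^ ξ j

/-- The map `Φ_Λ = (Φ_{ξ_1}, …, Φ_{ξ_q})` (meaningful on `U`). -/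
def masterMap {ℓ n q : ℕ} (A : AffineArrangement ℓ n) (Λ : Fin q → Fin n → ℤ)
    (x : Fin ℓ → ℂ) : Fin q → ℂ :=
  fun i => A.master (Λ i) x

/-- The image `Y = Φ_Λ(U)`. -/
def Y {ℓ n q : ℕ} (A : AffineArrangement ℓ n) (Λ : Fin q → Fin n → ℤ) : Set (Fin q → ℂ) :=
  A.masterMap Λ '' A.U

/-- The level set `{x ∈ U | Φ_ξ(x) = c}`. -/
def levelSet {ℓ n : ℕ} (A : AffineArrangement ℓ n) (ξ : Fin n → ℤ) (c : ℂ) :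
    Set (Fin ℓ → ℂ) :=
  {x | x ∈ A.U ∧ A.master ξ x = c}

/-- The fiber `Φ_Λ⁻¹(y) ⊆ U`. -/
def fiber {ℓ n q : ℕ} (A : AffineArrangement ℓ n) (Λ : Fin q → Fin n → ℤ) (y : Fin q → ℂ) :
    Set (Fin ℓ → ℂ) :=
  {x | x ∈ A.U ∧ A.masterMap Λ x = y}

/-- `Sing(Φ_Λ)`: the points of `U` at which the Jacobian of `Φ_Λ : U → Y` has rank smaller
than `dim Y`. -/
def singMap {ℓ n q : ℕ} (A : AffineArrangement ℓ n) (Λ : Fin q → Fin n → ℤ) :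
    Set (Fin ℓ → ℂ) :=
  {x | x ∈ A.U ∧
    (Module.finrank ℂ (LinearMap.range
      (fderiv ℂ (A.masterMap Λ) x : (Fin ℓ → ℂ) →ₗ[ℂ] (Fin q → ℂ))) : WithBot ℕ∞)
      < closureDim (A.Y Λ)}

/-- `S_Λ = Sing(Φ_Λ) ∪ Φ_Λ⁻¹(Sing Ȳ) ⊆ U`. -/
def S {ℓ n q : ℕ} (A : AffineArrangement ℓ n) (Λ : Fin q → Fin n → ℤ) : Set (Fin ℓ → ℂ) :=
  A.singMap Λ ∪ {x | x ∈ A.U ∧ A.masterMap Λ x ∈ closureSing (A.Y Λ)}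

end AffineArrangement

end

noncomputable section

/-! ### Algebraic and analytic preliminaries -/

/-! Write `ω_λ = ∑ c i • ω_{ξ_i}`. A point `z` of `U` is critical iff the covector `ω_λ(z)`
vanishes, and this covector is the pullback under `dΦ_Λ(z)` of `η_y = ∑ c i dy_i / y_i`, where `y =
Φ_Λ(z)`. The image of `dΦ_Λ(z)` always lies in the Zariski tangent space of `Ȳ` at `y`. At a point
off `S_Λ` it fills that space, since the rank is at least `dim Y` and the tangent space has
dimension at most `dim Y`. So if `x ∉ S_Λ` is critical, `η_y` kills the whole tangent space, and
every point of the fiber through `x` is critical (`fiber_subset_crit`).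

For the codimension, `codim crit ≤ codim fiber ≤ dim Y ≤ rank dΦ_Λ(x) ≤ p` at such an `x`. The
second inequality is the height bound for a prime minimal over an extended maximal ideal
(`codimension_fiber_le`). The third says `x ∉ Sing(Φ_Λ)`. The last holds because `⋀^(p+1) D →
A^(p+1)` is zero, so any `p + 1` forms of `D` are dependent at each point
(`finrank_range_fderiv_masterMap_le`). -/

/-- A prime that is minimal over the extension of a maximal ideal `m` has height at most that
of `m`. -/
theorem Ideal.height_le_of_mem_minimalPrimes_map_of_isMaximal {B R : Type*} [CommRing B]
    [CommRing R] [Algebra B R] [IsNoetherianRing B] [IsNoetherianRing R] (m : Ideal B)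
    [hm : m.IsMaximal] (P : Ideal R) (hP : P ∈ (m.map (algebraMap B R)).minimalPrimes) :
    P.height ≤ m.height := by
  have hPp : P.IsPrime := hP.1.1
  have hle : m ≤ P.comap (algebraMap B R) := Ideal.map_le_iff_le_comap.mp hP.1.2
  have : P.LiesOver m := ⟨hm.eq_of_le (Ideal.IsPrime.comap _).ne_top hle⟩
  -- The height of `P` is at most that of `m` plus the height of `P` modulo `m R`; the second term
  -- is zero by minimality of `P`.
  have h := Ideal.height_le_height_add_of_liesOver m P
  set J := m.map (algebraMap B R)
  have hmap : (P.map (Ideal.Quotient.mk J)).IsPrime :=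
    Ideal.isPrime_map_quotientMk_of_isPrime hP.1.2
  have h0 : (P.map (Ideal.Quotient.mk J)).height = 0 := by
    rw [Ideal.height_eq_zero_iff]
    refine ⟨⟨hmap, bot_le⟩, fun Q ⟨hQ, _⟩ hQP => ?_⟩
    have h1 : Q.comap (Ideal.Quotient.mk J) ≤ P := by
      refine (Ideal.comap_mono hQP).trans ?_
      rw [Ideal.comap_map_of_surjective _ Ideal.Quotient.mk_surjective, ← RingHom.ker_eq_comap_bot,
        Ideal.mk_ker]
      exact sup_le le_rfl hP.1.2
    have h2 : J ≤ Q.comap (Ideal.Quotient.mk J) := by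
      exact Ideal.mk_ker.ge.trans (Ideal.comap_mono bot_le)
    exact Ideal.map_le_iff_le_comap.mpr (hP.2 ⟨Ideal.IsPrime.comap _, h2⟩ h1)
  rwa [h0, add_zero] at h

/-- The exterior product of linearly independent vectors is nonzero. -/
theorem exteriorPower.ιMulti_ne_zero_of_linearIndependent {K V : Type*} [Field K]
    [AddCommGroup V] [Module K V] {k : ℕ} {v : Fin k → V} (hv : LinearIndependent K v) :
    exteriorPower.ιMulti K k v ≠ 0 := by
  obtain ⟨g, hg⟩ := (Fintype.linearCombination K v).exists_leftInverse_of_injective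
    (LinearMap.ker_eq_bot.mpr (hv.fintypeLinearCombination_injective))
  intro h
  -- The left inverse `g` sends `v` to the standard basis, so the alternating form `det ∘ g` takes
  -- the value 1 on `v`.
  have h1 := exteriorPower.alternatingMapLinearEquiv_apply_ιMulti
    ((Matrix.detRowAlternating (R := K) (n := Fin k)).compLinearMap g) v
  have h2 : (fun i => g (v i)) = (1 : Matrix (Fin k) (Fin k) K) := by
    funext i
    have h3 := LinearMap.congr_fun hg (Pi.single i 1)
    rw [LinearMap.comp_apply, Fintype.linearCombination_apply_single, one_smul] at h3
    rw [h3]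
    funext j
    simp [Matrix.one_apply, Pi.single_apply, eq_comm]
  rw [h, map_zero, AlternatingMap.compLinearMap_apply] at h1
  have h4 : Matrix.det (fun i => g (v i)) = 0 := h1.symm
  rw [h2, Matrix.det_one] at h4
  exact one_ne_zero h4

/-- A polynomial function is differentiable, its differential given by the partial
derivatives. -/
theorem MvPolynomial.hasFDerivAt_eval {m : ℕ} (P : MvPolynomial (Fin m) ℂ) (y : Fin m → ℂ) :
    HasFDerivAt (fun z => MvPolynomial.eval z P)
      (∑ j, MvPolynomial.eval y (MvPolynomial.pderiv j P) •
        (ContinuousLinearMap.proj j : (Fin m → ℂ) →L[ℂ] ℂ)) y := by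
  classical
  induction P using MvPolynomial.induction_on with
  | C a =>
    simp only [MvPolynomial.eval_C]
    exact (hasFDerivAt_const (𝕜 := ℂ) a y).congr_fderiv (by ext v; simp)
  | add P Q hP hQ =>
    simp only [map_add]
    exact (hP.add hQ).congr_fderiv (by ext v; simp [add_mul, Finset.sum_add_distrib])
  | mul_X P i hP =>
    have h := hP.mul (hasFDerivAt_apply (𝕜 := ℂ) i y)
    simp only [map_mul, MvPolynomial.eval_X]
    refine h.congr_fderiv ?_
    ext v
    simp [MvPolynomial.pderiv_X, Pi.single_apply, add_mul, Finset.sum_add_distrib,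
      Finset.mul_sum, ite_mul, apply_ite]
    ring_nf

/-- Logarithmic differentiation of a product. -/
theorem HasFDerivAt.finset_prod_of_log {E ι : Type*} [NormedAddCommGroup E] [NormedSpace ℂ E]
    (s : Finset ι) {g : ι → E → ℂ} {h : ι → E →L[ℂ] ℂ} {x : E}
    (hg : ∀ i ∈ s, HasFDerivAt (g i) (g i x • h i) x) :
    HasFDerivAt (fun y => ∏ i ∈ s, g i y) ((∏ i ∈ s, g i x) • ∑ i ∈ s, h i) x := by
  classical
  induction s using Finset.induction_on with
  | empty => simpa using hasFDerivAt_const (𝕜 := ℂ) (1 : ℂ) x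
  | insert a s ha ih =>
    have h1 := (hg a (Finset.mem_insert_self _ _)).mul
      (ih fun i hi => hg i (Finset.mem_insert_of_mem hi))
    simp only [Finset.prod_insert ha, Finset.sum_insert ha]
    refine h1.congr_fderiv ?_
    ext v
    simp
    ring

/-- If `exp ∘ L` agrees with `f` near `x`, then `dL = df / f`. -/
theorem HasFDerivAt.of_exp_eventuallyEq {E : Type*} [NormedAddCommGroup E] [NormedSpace ℂ E]
    {L f : E → ℂ} {f' : E →L[ℂ] ℂ} {x : E} (hL : DifferentiableAt ℂ L x)
    (h : ∀ᶠ y in 𝓝 x, Complex.exp (L y) = f y) (hf : HasFDerivAt f f' x) :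
    HasFDerivAt L ((f x)⁻¹ • f') x := by
  have h1 : HasFDerivAt f (Complex.exp (L x) • fderiv ℂ L x) x :=
    hL.hasFDerivAt.cexp.congr_of_eventuallyEq (h.mono fun y hy => hy.symm)
  have h2 := hf.unique h1
  have h3 : f x ≠ 0 := by rw [← h.self_of_nhds]; exact Complex.exp_ne_zero _
  rw [h2, h.self_of_nhds, smul_smul, inv_mul_cancel₀ h3, one_smul]
  exact hL.hasFDerivAt

namespace AffineArrangement

variable {ℓ n q : ℕ} (A : AffineArrangement ℓ n)

/-! ### The one-forms `ω_λ` at a point, and the critical locus -/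

/-- The covector `ω_λ(x) = ∑ λ i • df i / f i (x)`. -/
def logForm (lam : Fin n → ℂ) (x : Fin ℓ → ℂ) : Module.Dual ℂ (Fin ℓ → ℂ) :=
  ∑ i, lam i • ((A.f i x)⁻¹ • (A.f i).linear)

theorem evalAt_omega (lam : Fin n → ℂ) (x : A.U) :
    A.evalAt x (A.omega lam).1 = ExteriorAlgebra.ι ℂ (A.logForm lam x.1) := by
  simp only [omega, logForm, map_sum]
  refine Finset.sum_congr rfl fun i _ => ?_
  rw [map_smul, map_smul]
  rfl

theorem coe_f_eq (i : Fin n) : ⇑(A.f i) =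
    fun y => LinearMap.toContinuousLinearMap (A.f i).linear y + A.f i 0 := by
  conv_lhs => rw [AffineMap.decomp (A.f i)]
  rfl

theorem hasFDerivAt_f (i : Fin n) (x : Fin ℓ → ℂ) :
    HasFDerivAt (A.f i) (LinearMap.toContinuousLinearMap (A.f i).linear) x := by
  rw [A.coe_f_eq]
  exact (ContinuousLinearMap.hasFDerivAt _).add_const _

theorem hasFDerivAt_of_isBranch {lam : Fin n → ℂ} {x : Fin ℓ → ℂ} {g : (Fin ℓ → ℂ) → ℂ}
    (hg : A.IsBranch lam x g) :
    HasFDerivAt g (g x • LinearMap.toContinuousLinearMap (A.logForm lam x)) x := by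
  obtain ⟨L, hL, hgL⟩ := hg
  have h1 : ∀ i, HasFDerivAt (L i)
      ((A.f i x)⁻¹ • LinearMap.toContinuousLinearMap (A.f i).linear) x := fun i =>
    HasFDerivAt.of_exp_eventuallyEq (hL i).1.differentiableAt (hL i).2 (A.hasFDerivAt_f i x)
  have h2 := (HasFDerivAt.fun_sum (u := Finset.univ)
    fun i _ => (h1 i).const_mul (lam i)).cexp.congr_of_eventuallyEq hgL
  rw [← hgL.self_of_nhds] at h2
  refine h2.congr_fderiv ?_
  ext v
  simp [logForm]

theorem exists_isBranch (lam : Fin n → ℂ) {x : Fin ℓ → ℂ} (hx : x ∈ A.U) :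
    ∃ g, A.IsBranch lam x g := by
  have han : ∀ i, AnalyticAt ℂ (A.f i) x := fun i => by
    rw [A.coe_f_eq]
    exact (ContinuousLinearMap.analyticAt _ x).add analyticAt_const
  -- Dividing by `f i x` puts the argument at 1 when `y = x`, away from the cut of the principal
  -- logarithm.
  let L : Fin n → (Fin ℓ → ℂ) → ℂ := fun i y =>
    Complex.log (A.f i y / A.f i x) + Complex.log (A.f i x)
  refine ⟨fun y => Complex.exp (∑ i, lam i * L i y), ⟨L, fun i => ⟨?_, ?_⟩,
    Filter.Eventually.of_forall fun _ => rfl⟩⟩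
  · refine AnalyticAt.add (AnalyticAt.clog ((han i).div analyticAt_const (hx i)) ?_)
      analyticAt_const
    rw [div_self (hx i)]
    exact Complex.one_mem_slitPlane
  · filter_upwards [(han i).continuousAt.eventually_ne (hx i)] with y hy
    rw [Complex.exp_add, Complex.exp_log (div_ne_zero hy (hx i)), Complex.exp_log (hx i),
      div_mul_cancel₀ _ (hx i)]

/-- A branch of the master function does not vanish. -/
theorem IsBranch.ne_zero {lam : Fin n → ℂ} {x : Fin ℓ → ℂ} {g : (Fin ℓ → ℂ) → ℂ}
    (hg : A.IsBranch lam x g) : g x ≠ 0 := by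
  obtain ⟨L, -, hgL⟩ := hg
  rw [hgL.self_of_nhds]
  exact Complex.exp_ne_zero _

/-- A branch satisfies `dg = g • ω_λ` at `x` with `g x ≠ 0`, so criticality becomes a linear
condition free of branches. -/
theorem mem_crit_iff {lam : Fin n → ℂ} {x : Fin ℓ → ℂ} :
    x ∈ A.crit lam ↔ x ∈ A.U ∧ A.logForm lam x = 0 := by
  refine and_congr_right fun hx => ⟨fun ⟨g, hg, h0⟩ => ?_, fun h => ?_⟩
  · have h1 := (A.hasFDerivAt_of_isBranch hg).unique h0
    refine LinearMap.ext fun v => ?_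
    have h2 : g x * A.logForm lam x v = 0 :=
      congrArg (fun φ : (Fin ℓ → ℂ) →L[ℂ] ℂ => φ v) h1
    exact (mul_eq_zero.mp h2).resolve_left (IsBranch.ne_zero A hg)
  · obtain ⟨g, hg⟩ := A.exists_isBranch lam hx
    exact ⟨g, hg, (A.hasFDerivAt_of_isBranch hg).congr_fderiv (by ext v; simp [h])⟩

/-! ### The differential of the master map -/

theorem master_ne_zero (ξ : Fin n → ℤ) {x : Fin ℓ → ℂ} (hx : x ∈ A.U) : A.master ξ x ≠ 0 :=
  Finset.prod_ne_zero_iff.mpr fun j _ => zpow_ne_zero _ (hx j)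

theorem hasFDerivAt_master (ξ : Fin n → ℤ) {x : Fin ℓ → ℂ} (hx : x ∈ A.U) :
    HasFDerivAt (A.master ξ) (A.master ξ x •
      LinearMap.toContinuousLinearMap (A.logForm (fun j => (ξ j : ℂ)) x)) x := by
  have h := HasFDerivAt.finset_prod_of_log Finset.univ (x := x)
    (g := fun j y => A.f j y ^ ξ j)
    (h := fun j => (ξ j : ℂ) • ((A.f j x)⁻¹ • LinearMap.toContinuousLinearMap (A.f j).linear))
    fun j _ => by
      refine ((hasDerivAt_zpow (ξ j) (A.f j x) (Or.inl (hx j))).comp_hasFDerivAt x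
        (A.hasFDerivAt_f j x)).congr_fderiv ?_
      rw [smul_smul, smul_smul, zpow_sub_one₀ (hx j)]
      congr 1
      ring
  refine h.congr_fderiv ?_
  ext v
  simp [logForm, master]

theorem fderiv_masterMap_apply (Λ : Fin q → Fin n → ℤ) {x : Fin ℓ → ℂ} (hx : x ∈ A.U)
    (v : Fin ℓ → ℂ) (i : Fin q) : fderiv ℂ (A.masterMap Λ) x v i =
      A.masterMap Λ x i * A.logForm (fun j => (Λ i j : ℂ)) x v := by
  have h := hasFDerivAt_pi.mpr fun i => A.hasFDerivAt_master (Λ i) hx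
  have h' : HasFDerivAt (A.masterMap Λ) _ x := h
  rw [h'.fderiv]
  rfl

theorem differentiableAt_masterMap (Λ : Fin q → Fin n → ℤ) {x : Fin ℓ → ℂ} (hx : x ∈ A.U) :
    DifferentiableAt ℂ (A.masterMap Λ) x :=
  differentiableAt_pi.mpr fun i => (A.hasFDerivAt_master (Λ i) hx).differentiableAt

theorem isOpen_U : IsOpen A.U := by
  have h : A.U = ⋂ i, {x | A.f i x ≠ 0} := by ext x; simp [U]
  rw [h]
  exact isOpen_iInter_of_finite fun i => isOpen_ne_fun
    (continuous_iff_continuousAt.mpr fun y => (A.hasFDerivAt_f i y).continuousAt)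
    continuous_const

/-- The image of the differential of `Φ_Λ` lies in the Zariski tangent space of `Y`. -/
theorem range_fderiv_masterMap_le (Λ : Fin q → Fin n → ℤ) {x : Fin ℓ → ℂ} (hx : x ∈ A.U) :
    LinearMap.range (fderiv ℂ (A.masterMap Λ) x : (Fin ℓ → ℂ) →ₗ[ℂ] (Fin q → ℂ)) ≤
      zariskiTangentSpace (A.Y Λ) (A.masterMap Λ x) := by
  rintro _ ⟨v, rfl⟩ P hP
  have h1 := (P.hasFDerivAt_eval (A.masterMap Λ x)).comp x
    (A.differentiableAt_masterMap Λ hx).hasFDerivAt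
  have h2 : (fun z => MvPolynomial.eval z P) ∘ A.masterMap Λ =ᶠ[𝓝 x] fun _ => 0 := by
    filter_upwards [A.isOpen_U.mem_nhds hx] with z hz
    exact hP _ ⟨z, hz, rfl⟩
  have h3 := h1.unique ((hasFDerivAt_const (0 : ℂ) x).congr_of_eventuallyEq h2)
  simpa using congrArg (fun φ : (Fin ℓ → ℂ) →L[ℂ] ℂ => φ v) h3

/-! ### The rank of a subspace of `A¹` bounds the rank of the master map -/

/-- If `⋀^k D → A^k` vanishes, then the values at a point of any `k` master one-forms from `D`
are linearly dependent. -/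
theorem not_linearIndependent_logForm {D : Submodule ℂ A.A1} {k : ℕ} (h : A.MulVanishes D k)
    (c : Fin k → Fin n → ℂ) (hc : ∀ i, A.omega (c i) ∈ D) {x : Fin ℓ → ℂ} (hx : x ∈ A.U) :
    ¬ LinearIndependent ℂ fun i => A.logForm (c i) x := by
  intro hli
  refine exteriorPower.ιMulti_ne_zero_of_linearIndependent hli ?_
  have h1 := h _ (ExteriorAlgebra.ιMulti_range ℂ k
    ⟨fun i => (⟨A.omega (c i), hc i⟩ : D), rfl⟩)
  have h2 := congrArg (A.evalAt ⟨x, hx⟩) h1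
  rw [map_zero, ExteriorAlgebra.ιMulti_apply, map_list_prod, map_list_prod, List.map_ofFn,
    List.map_ofFn] at h2
  refine Subtype.ext ?_
  rw [exteriorPower.ιMulti_apply_coe, ExteriorAlgebra.ιMulti_apply]
  refine Eq.trans ?_ h2
  congr 2
  funext i
  simp only [Function.comp_apply, mulMap, ExteriorAlgebra.lift_ι_apply]
  exact (A.evalAt_omega (c i) ⟨x, hx⟩).symm

/-- The rows of the Jacobian are nonzero multiples of the covectors `ω_{ξ_i}(x)`, whose span `W` has
dimension at most `p`. -/
theorem finrank_range_fderiv_masterMap_le {D : Submodule ℂ A.A1} {p : ℕ}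
    (h : A.MulVanishes D (p + 1)) (Λ : Fin q → Fin n → ℤ)
    (hΛ : ∀ i, A.omega (fun j => (Λ i j : ℂ)) ∈ D) {x : Fin ℓ → ℂ} (hx : x ∈ A.U) :
    Module.finrank ℂ (LinearMap.range
      (fderiv ℂ (A.masterMap Λ) x : (Fin ℓ → ℂ) →ₗ[ℂ] (Fin q → ℂ))) ≤ p := by
  classical
  set φ := (fderiv ℂ (A.masterMap Λ) x : (Fin ℓ → ℂ) →ₗ[ℂ] (Fin q → ℂ)) with hφ
  set W : Submodule ℂ (Module.Dual ℂ (Fin ℓ → ℂ)) :=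
    Submodule.span ℂ (Set.range fun i => A.logForm (fun j => (Λ i j : ℂ)) x) with hW
  have h1 : Module.finrank ℂ W ≤ p := by
    by_contra! hp
    obtain ⟨κ, a, ha, hspan, hli⟩ := exists_linearIndependent' ℂ
      (fun i => A.logForm (fun j => (Λ i j : ℂ)) x)
    have : Finite κ := Finite.of_injective a ha
    have := Fintype.ofFinite κ
    have hcard : Fintype.card κ = Module.finrank ℂ W := by
      rw [hW, ← hspan, finrank_span_eq_card hli]
    obtain ⟨e⟩ : Nonempty (Fin (p + 1) ↪ κ) :=
      Function.Embedding.nonempty_of_card_le (by rw [Fintype.card_fin, hcard]; exact hp)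
    exact A.not_linearIndependent_logForm h (fun k j => (Λ (a (e k)) j : ℂ))
      (fun k => hΛ _) hx (hli.comp e e.injective)
  -- Rank-nullity then gives `rank φ ≤ ℓ - dim W^⊥ = dim W`.
  have h2 : W.dualCoannihilator ≤ LinearMap.ker φ := by
    intro v hv
    rw [LinearMap.mem_ker]
    funext i
    have h3 := A.fderiv_masterMap_apply Λ hx v i
    have h4 := (Submodule.mem_dualCoannihilator v).mp hv _ (Submodule.subset_span ⟨i, rfl⟩)
    exact h3.trans (by rw [h4, mul_zero]; rfl)
  have h3 := Submodule.finrank_mono h2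
  have h4 := Subspace.finrank_add_finrank_dualCoannihilator_eq W
  have h5 := φ.finrank_range_add_finrank_ker
  omega

/-! ### Critical points and fibers -/

/-- If `ω_λ = ∑ c i ω_{ξ_i}` as one-forms, then the same holds at each point of `U`. -/
theorem exists_logForm_eq {D : Submodule ℂ A.A1} {Λ : Fin q → Fin n → ℤ}
    (hΛ : A.IsIntegralBasis D Λ) {lam : Fin n → ℂ} (hlam : A.omega lam ∈ D) :
    ∃ c : Fin q → ℂ, ∀ x ∈ A.U,
      A.logForm lam x = ∑ i, c i • A.logForm (fun j => (Λ i j : ℂ)) x := by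
  rw [← hΛ.2] at hlam
  obtain ⟨c, hc⟩ := (Submodule.mem_span_range_iff_exists_fun ℂ).mp hlam
  refine ⟨c, fun x hx => (ExteriorAlgebra.ι_leftInverse (R := ℂ)).injective ?_⟩
  have h := congrArg (fun w : A.A1 => A.evalAt ⟨x, hx⟩ w.1) hc
  simp only [Submodule.coe_sum, Submodule.coe_smul, map_sum, map_smul, evalAt_omega] at h
  rw [← h, map_sum]
  simp only [map_smul]

/-- Away from `S_Λ`, with a critical point of `Φ_λ` its whole fiber of `Φ_Λ` is critical. -/
theorem fiber_subset_crit {D : Submodule ℂ A.A1} {Λ : Fin q → Fin n → ℤ}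
    (hΛ : A.IsIntegralBasis D Λ) {lam : Fin n → ℂ} (hlam : A.omega lam ∈ D) {x : Fin ℓ → ℂ}
    (hx : x ∈ A.crit lam) (hxS : x ∉ A.S Λ) :
    A.fiber Λ (A.masterMap Λ x) ⊆ A.crit lam := by
  obtain ⟨c, hc⟩ := A.exists_logForm_eq hΛ hlam
  obtain ⟨hxU, hx0⟩ := A.mem_crit_iff.mp hx
  -- The right side depends on `z` and `v` only through `Φ_Λ(z)` and the vector `dΦ_Λ(z) v`.
  have key : ∀ z ∈ A.U, ∀ v, A.logForm lam z v =
      ∑ i, c i * ((A.masterMap Λ z i)⁻¹ * fderiv ℂ (A.masterMap Λ) z v i) := by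
    intro z hz v
    rw [hc z hz, LinearMap.sum_apply]
    refine Finset.sum_congr rfl fun i _ => ?_
    have h : A.masterMap Λ z i ≠ 0 := A.master_ne_zero (Λ i) hz
    rw [A.fderiv_masterMap_apply Λ hz, inv_mul_cancel_left₀ h]
    rfl
  have hrange : LinearMap.range
      (fderiv ℂ (A.masterMap Λ) x : (Fin ℓ → ℂ) →ₗ[ℂ] (Fin q → ℂ)) =
      zariskiTangentSpace (A.Y Λ) (A.masterMap Λ x) := by
    refine Submodule.eq_of_le_of_finrank_le (A.range_fderiv_masterMap_le Λ hxU) ?_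
    have h1 : ¬ _ := fun h => hxS (Or.inl ⟨hxU, h⟩)
    have h2 : ¬ _ := fun h =>
      hxS (Or.inr ⟨hxU, ⟨fun P hP => hP _ ⟨x, hxU, rfl⟩, h⟩⟩)
    exact_mod_cast (not_lt.mp h2).trans (not_lt.mp h1)
  -- Here `z` may lie in `S_Λ`: only the inclusion of the image at `z` in the tangent space is
  -- needed, as equality is used at `x` alone.
  rintro z ⟨hzU, hz⟩
  refine A.mem_crit_iff.mpr ⟨hzU, LinearMap.ext fun v => ?_⟩
  have h1 := A.range_fderiv_masterMap_le Λ hzU ⟨v, rfl⟩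
  rw [hz, ← hrange] at h1
  obtain ⟨w, hw⟩ := h1
  have h2 := key x hxU w
  rw [hx0] at h2
  rw [key z hzU v, LinearMap.zero_apply, hz]
  refine Eq.trans (Finset.sum_congr rfl fun i _ => ?_) h2.symm
  exact congrArg (fun t : Fin q → ℂ => c i * ((A.masterMap Λ x i)⁻¹ * t i)) hw.symm

/-! ### The coordinate ring of the complement -/

/-- The polynomial defining the hyperplane `f j = 0`. -/
def poly (j : Fin n) : MvPolynomial (Fin ℓ) ℂ :=
  ∑ k, MvPolynomial.C ((A.f j).linear (Pi.single k 1)) * MvPolynomial.X k +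
    MvPolynomial.C (A.f j 0)

theorem eval_poly (j : Fin n) (x : Fin ℓ → ℂ) : MvPolynomial.eval x (A.poly j) = A.f j x := by
  have h : A.f j x = (A.f j).linear x + A.f j 0 := congrFun (AffineMap.decomp (A.f j)) x
  rw [h, LinearMap.pi_apply_eq_sum_univ (A.f j).linear x]
  simp only [poly, map_add, map_sum, map_mul, MvPolynomial.eval_C, MvPolynomial.eval_X,
    smul_eq_mul, mul_comm]
  congr! 4 with k
  funext i
  simp [Pi.single_apply, eq_comm]

/-- The defining polynomial of the arrangement. -/
def definingPoly : MvPolynomial (Fin ℓ) ℂ := ∏ j, A.poly j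

theorem eval_definingPoly_ne_zero_iff {x : Fin ℓ → ℂ} :
    MvPolynomial.eval x A.definingPoly ≠ 0 ↔ x ∈ A.U := by
  simp [definingPoly, Finset.prod_eq_zero_iff, eval_poly, U]

/-- The coordinate ring of the complement. -/
abbrev CoordRing : Type := Localization.Away A.definingPoly

/-- Evaluation of regular functions at a point of the complement. -/
def coordEval {x : Fin ℓ → ℂ} (hx : x ∈ A.U) : A.CoordRing →+* ℂ :=
  IsLocalization.Away.lift A.definingPoly (g := MvPolynomial.eval x)
    (A.eval_definingPoly_ne_zero_iff.mpr hx).isUnit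

@[simp]
theorem coordEval_algebraMap {x : Fin ℓ → ℂ} (hx : x ∈ A.U) (a : MvPolynomial (Fin ℓ) ℂ) :
    A.coordEval hx (algebraMap _ _ a) = MvPolynomial.eval x a :=
  IsLocalization.Away.lift_eq _ _ _

/-- A regular function vanishing on the complement is zero. -/
theorem eq_zero_of_coordEval {r : A.CoordRing}
    (h : ∀ (x : Fin ℓ → ℂ) (hx : x ∈ A.U), A.coordEval hx r = 0) : r = 0 := by
  obtain ⟨N, a, ha⟩ := IsLocalization.Away.surj A.definingPoly r
  have hu : IsUnit (algebraMap _ A.CoordRing A.definingPoly) :=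
    IsLocalization.Away.algebraMap_isUnit _
  -- The extra factor makes the product vanish off `U` too, hence at every point.
  have h0 : a * A.definingPoly = 0 := by
    refine MvPolynomial.funext fun x => ?_
    rw [map_mul, map_zero, mul_eq_zero, or_iff_not_imp_right]
    intro hx
    have hx' := A.eval_definingPoly_ne_zero_iff.mp hx
    rw [← A.coordEval_algebraMap hx', ← ha, map_mul, h x hx', zero_mul]
  have h1 := congrArg (algebraMap _ A.CoordRing) h0
  rw [map_mul, map_zero, hu.mul_left_eq_zero, ← ha, (hu.pow N).mul_left_eq_zero] at h1
  exact h1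

/-- The function `f j` as a unit of the coordinate ring. -/
def polyUnit (j : Fin n) : A.CoordRingˣ :=
  (IsLocalization.Away.isUnit_of_dvd (S := A.CoordRing) A.definingPoly
    (Finset.dvd_prod_of_mem A.poly (Finset.mem_univ j))).unit

/-- The pullback of functions along the master map `Φ_Λ`. -/
def pullback (Λ : Fin q → Fin n → ℤ) : MvPolynomial (Fin q) ℂ →+* A.CoordRing :=
  MvPolynomial.eval₂Hom ((algebraMap (MvPolynomial (Fin ℓ) ℂ) A.CoordRing).comp MvPolynomial.C)
    -- The product is formed in the unit group because the exponents may be negative.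
    fun i => ((∏ j, A.polyUnit j ^ Λ i j : A.CoordRingˣ) : A.CoordRing)

theorem coordEval_pullback (Λ : Fin q → Fin n → ℤ) {x : Fin ℓ → ℂ} (hx : x ∈ A.U)
    (Q : MvPolynomial (Fin q) ℂ) :
    A.coordEval hx (A.pullback Λ Q) = MvPolynomial.eval (A.masterMap Λ x) Q := by
  have h : (A.coordEval hx).comp (A.pullback Λ) = MvPolynomial.eval (A.masterMap Λ x) := by
    refine MvPolynomial.ringHom_ext (fun c => ?_) fun i => ?_
    · simp [pullback]
    · have hu : ∀ j, Units.map (A.coordEval hx : A.CoordRing →* ℂ) (A.polyUnit j) =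
          Units.mk0 (A.f j x) (hx j) := fun j => by
        ext
        rw [Units.coe_map, polyUnit, IsUnit.unit_spec]
        exact (A.coordEval_algebraMap hx _).trans (A.eval_poly j x)
      have h1 : A.coordEval hx ((∏ j, A.polyUnit j ^ Λ i j : A.CoordRingˣ) : A.CoordRing) =
          ((Units.map (A.coordEval hx : A.CoordRing →* ℂ) (∏ j, A.polyUnit j ^ Λ i j) : ℂˣ) : ℂ) :=
        rfl
      rw [RingHom.comp_apply, pullback, MvPolynomial.eval₂Hom_X', h1, map_prod,
        MvPolynomial.eval_X]
      simp [hu, masterMap, master]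
  exact congrArg (fun g => g Q) h

theorem pullback_eq_zero (Λ : Fin q → Fin n → ℤ) {Q : MvPolynomial (Fin q) ℂ}
    (hQ : Q ∈ MvPolynomial.vanishingIdeal ℂ (A.Y Λ)) : A.pullback Λ Q = 0 :=
  A.eq_zero_of_coordEval fun x hx => by
    rw [A.coordEval_pullback]
    exact hQ _ ⟨x, hx, rfl⟩

/-- A polynomial vanishing on `V(P) ∩ U` lies in `P`, for a prime `P` not containing the
defining polynomial. -/
theorem mem_of_eval_eq_zero (P : Ideal (MvPolynomial (Fin ℓ) ℂ)) [hP : P.IsPrime]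
    (hdef : A.definingPoly ∉ P) {g : MvPolynomial (Fin ℓ) ℂ}
    (hg : ∀ x ∈ A.U, (∀ a ∈ P, MvPolynomial.eval x a = 0) → MvPolynomial.eval x g = 0) :
    g ∈ P := by
  -- By the Nullstellensatz it suffices to vanish on `V(P)`; the defining polynomial takes care of
  -- the points outside `U`.
  have h : g * A.definingPoly ∈ P := by
    rw [← MvPolynomial.IsPrime.vanishingIdeal_zeroLocus (K := ℂ) P]
    intro x hx
    change MvPolynomial.eval x _ = 0
    rw [map_mul, mul_eq_zero, or_iff_not_imp_right]
    exact fun h => hg x (A.eval_definingPoly_ne_zero_iff.mp h) hx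
  exact (hP.mem_or_mem h).resolve_right hdef

/-- A nonempty fiber of `Φ_Λ` has codimension at most `dim Y`. -/
theorem codimension_fiber_le (Λ : Fin q → Fin n → ℤ) {x : Fin ℓ → ℂ} (hx : x ∈ A.U) :
    (codimension (A.fiber Λ (A.masterMap Λ x)) : WithBot ℕ∞) ≤ closureDim (A.Y Λ) := by
  set y := A.masterMap Λ x with hy
  let I := MvPolynomial.vanishingIdeal ℂ (A.Y Λ)
  let M : Ideal (MvPolynomial (Fin q) ℂ) := MvPolynomial.vanishingIdeal ℂ {y}
  have hM : M.IsMaximal := inferInstance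
  have hIM : I ≤ M := MvPolynomial.vanishingIdeal_anti_mono
    (Set.singleton_subset_iff.mpr ⟨x, hx, rfl⟩)
  let B := MvPolynomial (Fin q) ℂ ⧸ I
  -- `B` is the coordinate ring of `Ȳ`, and this is the comorphism of `Φ_Λ : U → Ȳ`.
  let _ : Algebra B A.CoordRing :=
    (Ideal.Quotient.lift I (A.pullback Λ) fun Q hQ => A.pullback_eq_zero Λ hQ).toAlgebra
  have hmk : ∀ Q, algebraMap B A.CoordRing (Ideal.Quotient.mk I Q) = A.pullback Λ Q :=
    fun Q => rfl
  let m : Ideal B := M.map (Ideal.Quotient.mk I)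
  have hm : m.IsMaximal := by
    refine (Ideal.map_eq_top_or_isMaximal_of_surjective _ Ideal.Quotient.mk_surjective
      hM).resolve_left fun h => hM.ne_top ?_
    have h1 := congrArg (Ideal.comap (Ideal.Quotient.mk I)) h
    rwa [Ideal.comap_map_of_surjective _ Ideal.Quotient.mk_surjective,
      ← RingHom.ker_eq_comap_bot, Ideal.mk_ker, Ideal.comap_top, sup_eq_left.mpr hIM] at h1
  -- The point `x` of the fiber shows that the extension of `m` is proper, so a minimal prime over
  -- it exists.
  have hker : m.map (algebraMap B A.CoordRing) ≤ RingHom.ker (A.coordEval hx) := by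
    rw [Ideal.map_map, Ideal.map_le_iff_le_comap]
    intro Q hQ
    rw [Ideal.mem_comap, RingHom.mem_ker, RingHom.comp_apply, hmk, A.coordEval_pullback]
    exact hQ y rfl
  have : (RingHom.ker (A.coordEval hx)).IsPrime := RingHom.ker_isPrime _
  have : IsNoetherianRing A.CoordRing :=
    IsLocalization.isNoetherianRing (Submonoid.powers A.definingPoly) _ inferInstance
  obtain ⟨P, hP, -⟩ := Ideal.exists_minimalPrimes_le hker
  have hPp : P.IsPrime := hP.1.1
  have hheight : P.height ≤ m.height :=
    Ideal.height_le_of_mem_minimalPrimes_map_of_isMaximal m P hP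
  have hunder := IsLocalization.height_under (Submonoid.powers A.definingPoly) P
  -- The zeros of the contracted prime in `U` lie in the fiber; contraction from the localization
  -- preserves height.
  have hle : MvPolynomial.vanishingIdeal ℂ (A.fiber Λ y) ≤ P.under (MvPolynomial (Fin ℓ) ℂ) := by
    intro g hg
    refine A.mem_of_eval_eq_zero _ (fun h => hPp.ne_top ?_) fun z hz hzP => hg z ⟨hz, ?_⟩
    · exact Ideal.eq_top_of_isUnit_mem _ h (IsLocalization.Away.algebraMap_isUnit _)
    · funext i
      have h1 : A.pullback Λ (MvPolynomial.X i - MvPolynomial.C (y i)) ∈ P := by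
        rw [← hmk]
        refine hP.1.2 (Ideal.mem_map_of_mem _ (Ideal.mem_map_of_mem _ ?_))
        rintro _ rfl
        simp
      -- Clearing denominators turns the equation `Φ_{ξ_i} = y_i` into a polynomial `a` of the
      -- contracted prime.
      obtain ⟨N, a, ha⟩ := IsLocalization.Away.surj A.definingPoly
        (A.pullback Λ (MvPolynomial.X i - MvPolynomial.C (y i)))
      have h2 : MvPolynomial.eval z a = 0 :=
        hzP a (by rw [Ideal.under_def, Ideal.mem_comap, ← ha]; exact P.mul_mem_right _ h1)
      rw [← A.coordEval_algebraMap hz, ← ha, map_mul, map_pow, A.coordEval_algebraMap,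
        A.coordEval_pullback, mul_eq_zero, or_iff_left
          (pow_ne_zero _ (A.eval_definingPoly_ne_zero_iff.mpr hz)), map_sub,
        MvPolynomial.eval_X, MvPolynomial.eval_C, sub_eq_zero] at h2
      exact h2
  refine le_trans ?_ (Ideal.height_le_ringKrullDim_of_ne_top hm.ne_top)
  exact WithBot.coe_le_coe.mpr ((Ideal.height_mono hle).trans (hunder.le.trans hheight))

theorem codimension_anti {m : ℕ} {Z W : Set (Fin m → ℂ)} (h : Z ⊆ W) :
    codimension W ≤ codimension Z :=
  Ideal.height_mono (MvPolynomial.vanishingIdeal_anti_mono h)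

/-- A singular subspace of `A¹` is nonzero. -/
theorem pos_of_isSingular {D : Submodule ℂ A.A1} (hsing : A.IsSingular D)
    {Λ : Fin q → Fin n → ℤ} (hΛ : A.IsIntegralBasis D Λ) {x : Fin ℓ → ℂ} (hx : x ∈ A.U) :
    0 < q := by
  have hfin : Module.finrank ℂ D = q := by
    rw [← hΛ.2, finrank_span_eq_card hΛ.1, Fintype.card_fin]
  refine Nat.pos_of_ne_zero fun h0 => ?_
  -- If `q = 0`, singularity would kill `⋀^0 D`, which contains 1.
  have h1 : A.mulMap D 1 = 0 := by
    refine hsing 1 ?_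
    rw [hfin, h0, ExteriorAlgebra.exteriorPower, pow_zero]
    exact Submodule.one_le.mp le_rfl
  have h2 := congrArg (A.evalAt ⟨x, hx⟩) h1
  rw [map_one, map_one, map_zero] at h2
  exact one_ne_zero h2

end AffineArrangement

end

/-- Let `D ⊆ A¹` be a rational singular subspace of rank `p` with integral basis `Λ`, and let
`d log Φ_λ ∈ D`. Then `crit(Φ_λ) ⊆ S_Λ` or `codim crit(Φ_λ) ≤ p`; and there are fibers of `Φ_Λ`,
each contained in `crit(Φ_λ)` and each an intersection of level sets of the master functions
`Φ_{ξ_i}`, whose union coincides with `crit(Φ_λ)` outside `S_Λ`. -/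
theorem mainTheorem5 {ℓ n q : ℕ} (A : AffineArrangement ℓ n) (D : Submodule ℂ A.A1)
    (hsing : A.IsSingular D) (p : ℕ) (hrank : A.HasRank D p)
    (Λ : Fin q → Fin n → ℤ) (hΛ : A.IsIntegralBasis D Λ)
    (lam : Fin n → ℂ) (hlam : A.omega lam ∈ D) :
    (A.crit lam ⊆ A.S Λ ∨ codimension (A.crit lam) ≤ (p : ℕ∞)) ∧
    ∃ T : Set (Fin q → ℂ), T ⊆ A.Y Λ ∧
      (⋃ y ∈ T, A.fiber Λ y) ⊆ A.crit lam ∧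
      A.crit lam \ A.S Λ = (⋃ y ∈ T, A.fiber Λ y) \ A.S Λ ∧
      ∀ y ∈ T, A.fiber Λ y = ⋂ i, A.levelSet (Λ i) (y i) := by
  constructor
  · rw [or_iff_not_imp_left, Set.not_subset]
    rintro ⟨x, hx, hxS⟩
    refine (AffineArrangement.codimension_anti (A.fiber_subset_crit hΛ hlam hx hxS)).trans ?_
    have hdim := not_lt.mp fun h => hxS (Or.inl ⟨hx.1, h⟩)
    have hvan : A.MulVanishes D (p + 1) := by
      by_contra h
      exact absurd (hrank.2 h) (by omega)
    have hle := A.finrank_range_fderiv_masterMap_le hvan Λ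
      (fun i => hΛ.2 ▸ Submodule.subset_span ⟨i, rfl⟩) hx.1
    exact_mod_cast ((A.codimension_fiber_le Λ hx.1).trans hdim).trans (Nat.cast_le.mpr hle)
  -- `T` is taken as large as possible: all points of `Y` with critical fiber.
  · refine ⟨{y | y ∈ A.Y Λ ∧ A.fiber Λ y ⊆ A.crit lam}, fun y hy => hy.1,
      Set.iUnion₂_subset fun y hy => hy.2, ?_, ?_⟩
    · refine Set.Subset.antisymm ?_ (Set.sdiff_subset_sdiff_left
        (Set.iUnion₂_subset fun y hy => hy.2))
      rintro x ⟨hx, hxS⟩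
      refine ⟨Set.mem_iUnion₂.mpr ⟨A.masterMap Λ x, ⟨⟨x, hx.1, rfl⟩, ?_⟩, hx.1, rfl⟩, hxS⟩
      exact A.fiber_subset_crit hΛ hlam hx hxS
    · rintro y ⟨⟨x, hx, -⟩, -⟩
      -- For `q = 0` the empty intersection would be all of `ℂ^ℓ`; one level set is needed to force
      -- membership in `U`.
      have hq := A.pos_of_isSingular hsing hΛ hx
      ext z
      simp only [AffineArrangement.fiber, AffineArrangement.levelSet, Set.mem_iInter,
        Set.mem_ofPred_eq]
      exact ⟨fun h i => ⟨h.1, congrFun h.2 i⟩,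
        fun h => ⟨(h ⟨0, hq⟩).1, funext fun i => (h i).2⟩⟩
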